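/- Let $n$ be an odd prime and let $K$ be a totally real number field that is cyclic of degree $n$ over $\mathbb{Q}$, with ring of integers $\mathcal{O}_K$. Assume that the class number of $K$ is odd, that $2$ is inert in $K$ (so $2\mathcal{O}_K$ is a prime ideal), and that every totally positive unit of $\mathcal{O}_K$ is a square in $\mathcal{O}_K^\times$. Let $$\mathbf{M}_4 = (\mathcal{O}_K/4\mathcal{O}_K)^\times \big/ \left((\mathcal{O}_K/4\mathcal{O}_K)^\times\right)^2$$ with its natural action of $\operatorname{Gal}(K/\mathbb{Q})$, and let $\mathbb{M}_{4,G}$ be the set of $\operatorname{Gal}(K/\mathbb{Q})$-orbits of $\mathbf{M}_4$. For $\alpha\in\mathcal{O}_K$ invertible modulo $4$, write $[\alpha]\in\mathbb{M}_{4,G}$ for the orbit of the class of $\alpha$. For $a,b\in K^\times$ let $(a,b)_2$ be the Hilbert symbol at the place $2\mathcal{O}_K$: $(a,b)_2=1$ if $ax^2+by^2=z^2$ has a solution $(x,y,z)\neq(0,0,0)$ in the completion of $K$ at $2\mathcal{O}_K$, and $(a,b)_2=-1$ otherwise. For $\alpha\in\mathcal{O}_K$ invertible modulo $4$ put $s(\alpha)=1$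 if $(\alpha,\alpha^\sigma)_2=1$ for all nontrivial $\sigma\in\operatorname{Gal}(K/\mathbb{Q})$, and $s(\alpha)=-1$ otherwise. Then the rule $[\alpha]\mapsto s(\alpha)$ is a well-defined map on $\mathbb{M}_{4,G}$: there is exactly one map $\star:\mathbb{M}_{4,G}\to\{\pm1\}$ such that $\star([\alpha])=s(\alpha)$ for every $\alpha\in\mathcal{O}_K$ invertible modulo $4$. In other words, the value does not depend on the representative modulo $4$, up to squares, or within the Galois orbit: if $\alpha,\beta\in\mathcal{O}_K$ are invertible modulo $4$ and $\alpha\equiv\beta^\tau\gamma^2 \pmod{4\mathcal{O}_K}$ for some $\tau\in\operatorname{Gal}(K/\mathbb{Q})$ and $\gamma\in\mathcal{O}_K$, then $s(\alpha)=s(\beta)$. -/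

import Mathlib

open NumberField IsDedekindDomain

noncomputable section

namespace Starlight

section SquareClasses

variable (K : Type*) [Field K] [NumberField K]

/-- The finite ring `𝓞 K / q 𝓞 K`. -/
abbrev ResidueRing (q : ℕ) : Type _ := 𝓞 K ⧸ Ideal.span {(q : 𝓞 K)}

/-- The group `M_q = (𝓞 K / q)ˣ / ((𝓞 K / q)ˣ)²`. -/
abbrev M (q : ℕ) : Type _ :=
  (ResidueRing K q)ˣ ⧸ (powMonoidHom 2 : (ResidueRing K q)ˣ →* (ResidueRing K q)ˣ).range

variable {K}

/-- The canonical projection `(𝓞 K / q)ˣ → M_q`. -/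
def M.ofUnit (q : ℕ) : (ResidueRing K q)ˣ →* M K q :=
  QuotientGroup.mk' (powMonoidHom 2 : (ResidueRing K q)ˣ →* (ResidueRing K q)ˣ).range

/-- The class in `M_q` of an algebraic integer `α` that is a unit modulo `q`. -/
def M.mk (q : ℕ) (α : 𝓞 K) (hα : IsUnit (α : ResidueRing K q)) : M K q :=
  M.ofUnit q hα.unit

/-- The ring endomorphism of `𝓞 K / q` induced by `σ`, sending `α mod q` to `σ α mod q`. -/
def residueMap (q : ℕ) (σ : Gal(K/ℚ)) : ResidueRing K q →+* ResidueRing K q :=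
  Ideal.quotientMap _ (MulSemiringAction.toRingHom Gal(K/ℚ) (𝓞 K) σ) (by
    rw [Ideal.span_le, Set.singleton_subset_iff]
    simp)

theorem residueMap_mk (q : ℕ) (σ : Gal(K/ℚ)) (α : 𝓞 K) :
    residueMap q σ (α : ResidueRing K q) = ((σ • α : 𝓞 K) : ResidueRing K q) :=
  rfl

/-- The endomorphism of `M_q` induced by `σ`. -/
def M.galMap (q : ℕ) (σ : Gal(K/ℚ)) : M K q →* M K q :=
  QuotientGroup.map _ _ (Units.map (residueMap q σ : ResidueRing K q →* ResidueRing K q)) (by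
    rintro _ ⟨u, rfl⟩
    exact ⟨Units.map (residueMap q σ : ResidueRing K q →* ResidueRing K q) u, by simp⟩)

theorem M.galMap_ofUnit (q : ℕ) (σ : Gal(K/ℚ)) (u : (ResidueRing K q)ˣ) :
    M.galMap q σ (M.ofUnit q u) =
      M.ofUnit q (Units.map (residueMap q σ : ResidueRing K q →* ResidueRing K q) u) :=
  rfl

/-- The natural action of `Gal(K/ℚ)` on `M_q`. -/
instance (q : ℕ) : MulAction Gal(K/ℚ) (M K q) where
  smul σ x := M.galMap q σ x
  one_smul x := by
    obtain ⟨u, rfl⟩ := QuotientGroup.mk'_surjective _ x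
    refine (M.galMap_ofUnit q 1 u).trans (congrArg (M.ofUnit q) (Units.ext ?_))
    obtain ⟨a, ha⟩ := Ideal.Quotient.mk_surjective (u : ResidueRing K q)
    simp only [Units.coe_map, MonoidHom.coe_coe, ← ha]
    exact (residueMap_mk q 1 a).trans (by rw [one_smul])
  mul_smul σ τ x := by
    obtain ⟨u, rfl⟩ := QuotientGroup.mk'_surjective _ x
    refine (M.galMap_ofUnit q (σ * τ) u).trans (congrArg (M.ofUnit q) (Units.ext ?_))
    obtain ⟨a, ha⟩ := Ideal.Quotient.mk_surjective (u : ResidueRing K q)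
    simp only [Units.coe_map, MonoidHom.coe_coe, ← ha]
    exact (residueMap_mk q (σ * τ) a).trans (by rw [mul_smul]; rfl)

variable (K) in
/-- The set of `Gal(K/ℚ)`-orbits of `M_q`. -/
abbrev MOrbits (q : ℕ) : Type _ := MulAction.orbitRel.Quotient Gal(K/ℚ) (M K q)

/-- The Galois orbit `[α]` of the class in `M_q` of `α`, for `α` a unit modulo `q`. -/
def MOrbits.mk (q : ℕ) (α : 𝓞 K) (hα : IsUnit (α : ResidueRing K q)) : MOrbits K q :=
  Quotient.mk _ (M.mk q α hα)

end SquareClasses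

section HilbertSymbol

variable {K : Type*} [Field K] [NumberField K]

open Classical in
/-- The Hilbert symbol `(a, b)_v` at a finite place `v` of `K`: it is `1` if
`a x² + b y² = z²` has a nontrivial solution in the completion of `K` at `v`, and `-1` otherwise. -/
def hilbertSymbol (v : HeightOneSpectrum (𝓞 K)) (a b : K) : ℤˣ :=
  if ∃ x y z : v.adicCompletion K, (x ≠ 0 ∨ y ≠ 0 ∨ z ≠ 0) ∧
      algebraMap K (v.adicCompletion K) a * x ^ 2 +
        algebraMap K (v.adicCompletion K) b * y ^ 2 = z ^ 2
  then 1 else -1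

/-- The finite place `2 𝓞 K` of a number field in which `2` is inert. -/
def placeTwo (h2 : (Ideal.span {(2 : 𝓞 K)}).IsPrime) : HeightOneSpectrum (𝓞 K) where
  asIdeal := Ideal.span {(2 : 𝓞 K)}
  isPrime := h2
  ne_bot := by simp

open Classical in
/-- The value `1` if `(α, α^σ)_2 = 1` for all nontrivial `σ ∈ Gal(K/ℚ)`, and `-1` otherwise. -/
def starValue (h2 : (Ideal.span {(2 : 𝓞 K)}).IsPrime) (α : 𝓞 K) : ℤˣ :=
  if ∀ σ : Gal(K/ℚ), σ ≠ 1 →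
      hilbertSymbol (placeTwo h2) (α : K) ((σ • α : 𝓞 K) : K) = 1
  then 1 else -1

/-- An element of a number field is totally positive if it is positive in every real embedding. -/
def IsTotallyPositive (a : K) : Prop := ∀ φ : K →+* ℝ, 0 < φ a

end HilbertSymbol

end Starlight

end

namespace Starlight

/-! For `a`, `b` prime to `2`, the symbol at `2` is `1` exactly when `a x² + b y² ≡ z² (mod 4)` has
a solution not vanishing mod `2` (`hilbertSymbol_placeTwo_eq_one_iff`). Such a congruence lifts to
one mod `8` because the residue field is finite of characteristic two, where every element is a
square; a Hensel argument then gives an exact solution. The congruence sees `a`, `b` only mod `4`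
and up to squares of elements prime to `2`, and it is Galois invariant. As the Galois group is
commutative, replacing `α` by `α^τ` conjugates each pair `(α, α^σ)` by `τ`, so `starValue` descends
to orbits. -/

/-- In a complete ultrametric field of residue characteristic two, `1 + 8e` is a square for every
integral `e`, and its square root is nonzero. -/
theorem isSquare_one_add_eight_mul {F : Type*} [NormedField F] [CompleteSpace F]
    [IsUltrametricDist F] (h2 : ‖(2 : F)‖ < 1) {e : F} (he : ‖e‖ ≤ 1) :
    ∃ c ≠ 0, 1 + 8 * e = c ^ 2 := by
  -- A fixed point `t = 2e - t²` gives `(1 + 2t)² = 1 + 4(t + t²) = 1 + 8e`. On the ball of radius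
  -- `‖2‖`, `f` contracts because `‖t + u‖ ≤ ‖2‖`.
  set f : F → F := fun t ↦ 2 * e - t ^ 2 with hf
  set s : Set F := Metric.closedBall 0 ‖(2 : F)‖ with hs
  have hmaps : Set.MapsTo f s s := by
    intro t ht
    simp only [hs, mem_closedBall_zero_iff] at ht ⊢
    simp only [hf, sub_eq_add_neg]
    refine (IsUltrametricDist.norm_add_le_max _ _).trans (max_le ?_ ?_)
    · rw [norm_mul]
      exact mul_le_of_le_one_right (norm_nonneg _) he
    · rw [norm_neg, norm_pow, sq]
      exact (mul_le_of_le_one_right (norm_nonneg _) (ht.trans h2.le)).trans ht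
  have hcontr : ContractingWith ‖(2 : F)‖₊ (hmaps.restrict f s s) := by
    refine ⟨h2, LipschitzWith.of_dist_le_mul ?_⟩
    rintro ⟨t, ht⟩ ⟨u, hu⟩
    simp only [hs, mem_closedBall_zero_iff] at ht hu
    simp only [Subtype.dist_eq, Set.MapsTo.val_restrict_apply, hf, dist_eq_norm, coe_nnnorm]
    rw [show 2 * e - t ^ 2 - (2 * e - u ^ 2) = -(t + u) * (t - u) by ring, norm_mul, norm_neg]
    gcongr
    exact (IsUltrametricDist.norm_add_le_max _ _).trans (max_le ht hu)
  obtain ⟨t, hts, ht, -⟩ := hcontr.exists_fixedPoint' Metric.isClosed_closedBall.isComplete hmaps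
    (x := 0) (by simp [hs]) (edist_ne_top _ _)
  have ht' : 2 * e - t ^ 2 = t := ht
  refine ⟨1 + 2 * t, fun h0 ↦ ?_, by linear_combination 4 * ht'⟩
  have hlt : ‖2 * t‖ < 1 := by
    rw [norm_mul]
    exact (mul_le_of_le_one_right (norm_nonneg _)
      ((mem_closedBall_zero_iff.1 hts).trans h2.le)).trans_lt h2
  rw [eq_neg_of_add_eq_zero_right h0] at hlt
  simp at hlt

/-- Over a finite field of characteristic two, the correction needed to lift a solution of
`a x² + b y² = z²` modulo four to one modulo eight. -/
theorem exists_correction {F : Type*} [Field F] [Finite F] [CharP F 2] {a b x y z : F}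
    (ha : a ≠ 0) (hb : b ≠ 0)
    (h : a * x ^ 2 + b * y ^ 2 = z ^ 2) (d : F) :
    ∃ r s t : F, d + a * (x * r + r ^ 2) + b * (y * s + s ^ 2) - (z * t + t ^ 2) = 0 := by
  have hsq (c : F) : ∃ r, r ^ 2 = c :=
    (FiniteField.isSquare_of_char_two (CharP.ringChar_of_prime_eq_zero Nat.prime_two
      (CharP.cast_eq_zero F 2)) c).imp fun r hr ↦ by rw [hr, sq]
  have h2 : (2 : F) = 0 := CharTwo.two_eq_zero
  -- If a coordinate vanishes, its linear term drops out and a square root absorbs `d`.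
  by_cases hx : x = 0
  · obtain ⟨r, hr⟩ := hsq (-d / a)
    refine ⟨r, 0, 0, ?_⟩
    rw [hx, hr]
    field_simp
    ring
  by_cases hy : y = 0
  · obtain ⟨s, hs⟩ := hsq (-d / b)
    refine ⟨0, s, 0, ?_⟩
    rw [hy, hs]
    field_simp
    ring
  by_cases hz : z = 0
  · obtain ⟨t, ht⟩ := hsq d
    refine ⟨0, 0, t, ?_⟩
    rw [hz, ht]
    ring
  -- Put `A = a x²`, `B = b y²`, so `A + B = z²`. With `r = x q` and `s = y (A q / B)` the linear
  -- terms sum to `2 A q = 0`, and the quadratic ones to `A z² q² / B`.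
  obtain ⟨q, hq⟩ := hsq (d * (b * y ^ 2) / (a * x ^ 2 * z ^ 2))
  have hq' : a * x ^ 2 * z ^ 2 * q ^ 2 = d * (b * y ^ 2) := by
    rw [hq]
    field_simp
  refine ⟨x * q, y * (a * x ^ 2 * q / (b * y ^ 2)), 0, ?_⟩
  field_simp
  linear_combination (-1) * hq' + a * x ^ 2 * q ^ 2 * h +
    (a * b * x ^ 2 * y ^ 2 * q + a * x ^ 2 * z ^ 2 * q ^ 2) * h2

variable {K : Type*} [Field K] [NumberField K]

/-! ### Hilbert symbols at two as congruences mod four -/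

/-- The congruence `a x² + b y² ≡ z² (mod 4)` has a solution that does not vanish modulo `2`. -/
def IsSolvableModFour (a b : 𝓞 K) : Prop :=
  ∃ x y z : 𝓞 K, (¬ 2 ∣ x ∨ ¬ 2 ∣ y ∨ ¬ 2 ∣ z) ∧ 4 ∣ a * x ^ 2 + b * y ^ 2 - z ^ 2

/-- Since `(x + 2r)² = x² + 4(x r + r²)`, shifting the solution by `2(r, s, t)` changes the quotient
by `4` as in `exists_correction`. The case `x`, `z` both even is excluded, since it would force `y`
even. -/
theorem IsSolvableModFour.exists_mod_eight (h2 : (Ideal.span {(2 : 𝓞 K)}).IsPrime) {a b : 𝓞 K}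
    (ha : ¬ 2 ∣ a) (hb : ¬ 2 ∣ b) (h : IsSolvableModFour a b) :
    ∃ x y z : 𝓞 K, (¬ 2 ∣ x ∨ ¬ 2 ∣ z) ∧ 8 ∣ a * x ^ 2 + b * y ^ 2 - z ^ 2 := by
  obtain ⟨x, y, z, hxyz, d, hd⟩ := h
  set P : Ideal (𝓞 K) := Ideal.span {(2 : 𝓞 K)} with hP
  have hPmax : P.IsMaximal := h2.isMaximal (by simp [hP])
  let := Ideal.Quotient.field P
  have : Finite (𝓞 K ⧸ P) := Ideal.finiteQuotientOfFreeOfNeBot P (by simp [hP])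
  have hmk (r : 𝓞 K) : Ideal.Quotient.mk P r = 0 ↔ 2 ∣ r := by
    rw [Ideal.Quotient.eq_zero_iff_mem, hP, Ideal.mem_span_singleton]
  have : CharP (𝓞 K ⧸ P) 2 :=
    CharTwo.of_one_ne_zero_of_two_eq_zero one_ne_zero ((hmk 2).2 dvd_rfl)
  have hmod : Ideal.Quotient.mk P a * Ideal.Quotient.mk P x ^ 2 +
      Ideal.Quotient.mk P b * Ideal.Quotient.mk P y ^ 2 = Ideal.Quotient.mk P z ^ 2 := by
    rw [← sub_eq_zero]
    simp only [← map_mul, ← map_pow, ← map_add, ← map_sub]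
    rw [hmk, hd]
    exact ⟨2 * d, by ring⟩
  obtain ⟨r, s, t, hrst⟩ := exists_correction ((hmk a).not.2 ha) ((hmk b).not.2 hb) hmod
    (Ideal.Quotient.mk P d)
  obtain ⟨r, rfl⟩ := Ideal.Quotient.mk_surjective r
  obtain ⟨s, rfl⟩ := Ideal.Quotient.mk_surjective s
  obtain ⟨t, rfl⟩ := Ideal.Quotient.mk_surjective t
  simp only [← map_mul, ← map_pow, ← map_add, ← map_sub] at hrst
  obtain ⟨c, hc⟩ := (hmk _).1 hrst
  have hp : Prime (2 : 𝓞 K) := (Ideal.span_singleton_prime two_ne_zero).1 h2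
  have hadd (u w : 𝓞 K) : 2 ∣ u + 2 * w ↔ 2 ∣ u := dvd_add_left (dvd_mul_right _ _)
  refine ⟨x + 2 * r, y + 2 * s, z + 2 * t, ?_, c, by linear_combination hd + 4 * hc⟩
  rw [hadd, hadd]
  by_contra! hxz
  refine hxyz.elim (fun h ↦ h hxz.1) fun h ↦ h.elim (fun hy ↦ hy ?_) fun h ↦ h hxz.2
  have : 2 ∣ b * y ^ 2 := by
    rw [show b * y ^ 2 = 2 * (2 * d) + z * z - a * x * x by linear_combination hd]
    exact dvd_sub (dvd_add (dvd_mul_right _ _) (hxz.2.mul_left _)) (hxz.1.mul_left _)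
  exact (hp.dvd_or_dvd this).elim (fun h ↦ absurd h hb) hp.dvd_of_dvd_pow

/-- Elements of the ring of integers approximate the integers of an adic completion. -/
theorem exists_valued_algebraMap_sub_lt (v : HeightOneSpectrum (𝓞 K)) {x : v.adicCompletion K}
    (hx : Valued.v x ≤ 1) (n : ℕ) :
    ∃ r : 𝓞 K, Valued.v (algebraMap K (v.adicCompletion K) r - x) ≤ WithZero.exp (-(n : ℤ)) := by
  have hγ : WithZero.exp (-(n : ℤ)) ≤ 1 := by
    rw [← WithZero.exp_zero, WithZero.exp_le_exp]
    simp
  have hopen : IsOpen {y : v.adicCompletion K | Valued.v (y - x) ≤ WithZero.exp (-(n : ℤ))} := by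
    obtain ⟨p, hp⟩ := HeightOneSpectrum.valuedAdicCompletion_surjective K v
      (WithZero.exp (-(n : ℤ)))
    have hp0 : p ≠ 0 := by
      rintro rfl
      exact WithZero.exp_ne_zero (hp.symm.trans (map_zero _))
    have : Continuous fun y : v.adicCompletion K ↦ (y - x) / p := by fun_prop
    convert (Valued.isOpen_integer (v.adicCompletion K)).preimage this using 1
    ext y
    rw [Set.mem_ofPred_eq, Set.mem_preimage, SetLike.mem_coe, Valuation.mem_integer_iff, map_div₀,
      hp, div_le_one₀ WithZero.exp_pos]
  -- Approximation in two stages: by `K` in the completion, then by `𝓞 K` among the `v`-integral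
  -- elements of `K`.
  obtain ⟨k, hk⟩ := (HeightOneSpectrum.denseRange_algebraMap (R := 𝓞 K) K v).exists_mem_open hopen
    ⟨x, by simp⟩
  rw [Set.mem_ofPred_eq] at hk
  have hk1 : v.valuation K k ≤ 1 := by
    rw [← HeightOneSpectrum.valuedAdicCompletion_eq_valuation']
    calc _ = Valued.v ((algebraMap K (v.adicCompletion K) k - x) + x) := by rw [sub_add_cancel]; rfl
      _ ≤ _ := (Valuation.map_add _ _ _).trans (max_le (hk.trans hγ) hx)
  obtain ⟨r, hr⟩ := HeightOneSpectrum.exists_valuation_sub_lt_of_integer v hk1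
    (Units.mk0 (WithZero.exp (-(n : ℤ))) WithZero.exp_ne_zero)
  refine ⟨r, ?_⟩
  rw [← sub_add_sub_cancel _ (algebraMap K (v.adicCompletion K) k)]
  refine (Valuation.map_add _ _ _).trans (max_le ?_ hk)
  rw [← map_sub]
  exact (HeightOneSpectrum.valuedAdicCompletion_eq_valuation' v _).trans_le hr.le

/-- Dividing by a coordinate of largest valuation makes the solution integral with a unit
coordinate. Approximating it mod `4` by elements of `𝓞 K` keeps that coordinate prime to `2`. -/
theorem IsSolvableModFour.of_solution (v : HeightOneSpectrum (𝓞 K))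
    (hv : v.asIdeal = Ideal.span {(2 : 𝓞 K)}) {a b : 𝓞 K}
    {x y z : v.adicCompletion K} (hxyz : x ≠ 0 ∨ y ≠ 0 ∨ z ≠ 0)
    (h : algebraMap K (v.adicCompletion K) a * x ^ 2 +
      algebraMap K (v.adicCompletion K) b * y ^ 2 = z ^ 2) :
    IsSolvableModFour a b := by
  -- an integral solution one of whose coordinates is `1`
  have key : ∃ x y z : v.adicCompletion K, Valued.v x ≤ 1 ∧ Valued.v y ≤ 1 ∧ Valued.v z ≤ 1 ∧
      (Valued.v x = 1 ∨ Valued.v y = 1 ∨ Valued.v z = 1) ∧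
      algebraMap K (v.adicCompletion K) a * x ^ 2 +
        algebraMap K (v.adicCompletion K) b * y ^ 2 = z ^ 2 := by
    have scale (m : v.adicCompletion K) (hx : Valued.v x ≤ Valued.v m)
        (hy : Valued.v y ≤ Valued.v m) (hz : Valued.v z ≤ Valued.v m)
        (hm : m = x ∨ m = y ∨ m = z) : ∃ x y z : v.adicCompletion K,
        Valued.v x ≤ 1 ∧ Valued.v y ≤ 1 ∧ Valued.v z ≤ 1 ∧
        (Valued.v x = 1 ∨ Valued.v y = 1 ∨ Valued.v z = 1) ∧
        algebraMap K (v.adicCompletion K) a * x ^ 2 +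
          algebraMap K (v.adicCompletion K) b * y ^ 2 = z ^ 2 := by
      have hm0 : m ≠ 0 := by
        rintro rfl
        simp only [map_zero, le_zero_iff, map_eq_zero] at hx hy hz
        simp [hx, hy, hz] at hxyz
      have hv0 : 0 < Valued.v m := zero_lt_iff.2 ((map_ne_zero _).2 hm0)
      refine ⟨x / m, y / m, z / m, ?_, ?_, ?_, ?_, ?_⟩
      · rwa [map_div₀, div_le_one₀ hv0]
      · rwa [map_div₀, div_le_one₀ hv0]
      · rwa [map_div₀, div_le_one₀ hv0]
      · rcases hm with rfl | rfl | rfl <;> simp [div_self hm0]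
      · field_simp
        exact h
    rcases le_total (Valued.v x) (Valued.v y) with hxy | hxy
    · rcases le_total (Valued.v y) (Valued.v z) with hyz | hyz
      · exact scale z (hxy.trans hyz) hyz le_rfl (by simp)
      · exact scale y hxy le_rfl hyz (by simp)
    · rcases le_total (Valued.v x) (Valued.v z) with hxz | hxz
      · exact scale z hxz (hxy.trans hxz) le_rfl (by simp)
      · exact scale x le_rfl hxy hxz (by simp)
  clear h hxyz x y z
  obtain ⟨x, y, z, hx, hy, hz, hxyz, h⟩ := key
  have hdvd (r : 𝓞 K) (n : ℕ) : Valued.v (algebraMap K (v.adicCompletion K) r) ≤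
      WithZero.exp (-(n : ℤ)) ↔ 2 ^ n ∣ r := by
    rw [← Ideal.mem_span_singleton, ← Ideal.span_singleton_pow, ← hv]
    refine Iff.trans ?_ (v.intValuation_le_pow_iff_mem r n)
    rw [← HeightOneSpectrum.valuation_of_algebraMap (K := K),
      ← HeightOneSpectrum.valuedAdicCompletion_eq_valuation']
    rfl
  have happrox {w : v.adicCompletion K} (hw : Valued.v w ≤ 1) : ∃ r : 𝓞 K,
      Valued.v (algebraMap K (v.adicCompletion K) r - w) ≤ WithZero.exp (-2 : ℤ) ∧
      Valued.v (algebraMap K (v.adicCompletion K) r) ≤ 1 ∧ (Valued.v w = 1 → ¬ 2 ∣ r) := by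
    obtain ⟨r, hr⟩ := exists_valued_algebraMap_sub_lt v hw 2
    refine ⟨r, hr, by simpa using (hdvd r 0).2 (by simp), fun hw1 h2r ↦ ?_⟩
    have h1 := (hdvd r 1).2 (by simpa using h2r)
    have h3 : Valued.v w ≤ WithZero.exp (-1 : ℤ) := by
      rw [show w = algebraMap K (v.adicCompletion K) r - (algebraMap K (v.adicCompletion K) r - w)
        by ring]
      exact (Valuation.map_sub _ _ _).trans (max_le (by simpa using h1)
        (hr.trans (WithZero.exp_le_exp.2 (by norm_num))))
    rw [hw1, ← WithZero.exp_zero, WithZero.exp_le_exp] at h3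
    omega
  obtain ⟨r, hr, hr1, hrx⟩ := happrox hx
  obtain ⟨s, hs, hs1, hsy⟩ := happrox hy
  obtain ⟨t, ht, ht1, htz⟩ := happrox hz
  refine ⟨r, s, t, hxyz.imp hrx (Or.imp hsy htz), ?_⟩
  have hint (c : 𝓞 K) : Valued.v (algebraMap K (v.adicCompletion K) c) ≤ 1 := by
    simpa using (hdvd c 0).2 (by simp)
  have hmul {c d e : v.adicCompletion K} (hc : Valued.v c ≤ 1)
      (hd : Valued.v d ≤ WithZero.exp (-2 : ℤ)) (he : Valued.v e ≤ 1) :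
      Valued.v (c * d * e) ≤ WithZero.exp (-2 : ℤ) := by
    rw [map_mul, map_mul]
    exact (mul_le_of_le_one_right zero_le he).trans ((mul_le_of_le_one_left zero_le hc).trans hd)
  have hadd {c d : v.adicCompletion K} (hc : Valued.v c ≤ 1) (hd : Valued.v d ≤ 1) :
      Valued.v (c + d) ≤ 1 := (Valuation.map_add _ _ _).trans (max_le hc hd)
  rw [show (4 : 𝓞 K) = 2 ^ 2 by norm_num, ← hdvd]
  have hexpand : algebraMap K (v.adicCompletion K) ((a * r ^ 2 + b * s ^ 2 - t ^ 2 : 𝓞 K) : K) =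
      algebraMap K _ a * (algebraMap K _ r - x) * (algebraMap K _ r + x) +
        algebraMap K _ b * (algebraMap K _ s - y) * (algebraMap K _ s + y) -
        1 * (algebraMap K _ t - z) * (algebraMap K _ t + z) := by
    rw [RingOfIntegers.coe_eq_algebraMap]
    simp only [map_add, map_sub, map_mul, map_pow]
    linear_combination h
  rw [hexpand]
  refine (Valuation.map_sub _ _ _).trans
    (max_le ((Valuation.map_add _ _ _).trans (max_le ?_ ?_)) ?_)
  · exact hmul (hint a) hr (hadd hr1 hx)
  · exact hmul (hint b) hs (hadd hs1 hy)
  · exact hmul (by simp) ht (hadd ht1 hz)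

/-- The error `8e` of a solution mod `8` is absorbed by rescaling whichever of `x`, `z` is a unit by
a square root of `1 - 8e/(a x²)` or `1 + 8e/z²`. -/
theorem IsSolvableModFour.exists_solution (v : HeightOneSpectrum (𝓞 K))
    (hv : v.asIdeal = Ideal.span {(2 : 𝓞 K)}) {a b : 𝓞 K}
    (ha : ¬ 2 ∣ a) (hb : ¬ 2 ∣ b) (h : IsSolvableModFour a b) :
    ∃ x y z : v.adicCompletion K, (x ≠ 0 ∨ y ≠ 0 ∨ z ≠ 0) ∧
      algebraMap K (v.adicCompletion K) a * x ^ 2 +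
        algebraMap K (v.adicCompletion K) b * y ^ 2 = z ^ 2 := by
  obtain ⟨x, y, z, hxz, e, he⟩ := h.exists_mod_eight (hv ▸ v.isPrime) ha hb
  let f : 𝓞 K →+* v.adicCompletion K :=
    (algebraMap K (v.adicCompletion K)).comp (algebraMap (𝓞 K) K)
  have hle (r : 𝓞 K) : ‖f r‖ ≤ 1 := FinitePlace.norm_le_one K v r
  have hone {r : 𝓞 K} (hr : ¬ 2 ∣ r) : ‖f r‖ = 1 :=
    (FinitePlace.norm_eq_one_iff_notMem K v r).2 (by
      rwa [hv, Ideal.mem_span_singleton])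
  have hne {r : 𝓞 K} (hr : ¬ 2 ∣ r) : f r ≠ 0 := norm_ne_zero_iff.1 (by simp [hone hr])
  have h2lt : ‖(2 : v.adicCompletion K)‖ < 1 := by
    have : ‖f 2‖ < 1 := (FinitePlace.norm_lt_one_iff_mem K v (2 : 𝓞 K)).2
      (hv ▸ Ideal.mem_span_singleton_self (2 : 𝓞 K))
    rwa [map_ofNat] at this
  have hf : f a * f x ^ 2 + f b * f y ^ 2 - f z ^ 2 = 8 * f e := by
    simpa only [map_add, map_sub, map_mul, map_pow, map_ofNat] using congrArg f he
  rcases hxz with hx | hz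
  · obtain ⟨c, hc0, hc⟩ := isSquare_one_add_eight_mul h2lt (e := - f e / (f a * f x ^ 2)) (by
      simpa [hone ha, hone hx] using hle e)
    have ha0 := hne ha
    have hx0 := hne hx
    refine ⟨f x * c, f y, f z, Or.inl (mul_ne_zero hx0 hc0), ?_⟩
    change f a * _ + f b * _ = _
    field_simp at hc
    linear_combination hf - hc
  · obtain ⟨c, hc0, hc⟩ := isSquare_one_add_eight_mul h2lt (e := f e / f z ^ 2) (by
      simpa [hone hz] using hle e)
    have hz0 := hne hz
    refine ⟨f x, f y, f z * c, Or.inr (Or.inr (mul_ne_zero hz0 hc0)), ?_⟩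
    change f a * _ + f b * _ = _
    field_simp at hc
    linear_combination hf + hc

theorem ite_one_neg_one_eq_one_iff {p : Prop} {_ : Decidable p} :
    (if p then (1 : ℤˣ) else -1) = 1 ↔ p := by
  split_ifs with h
  · simp [h]
  · simp [h]

/-- The Hilbert symbol at two of elements prime to two is given by a congruence modulo four. -/
theorem hilbertSymbol_placeTwo_eq_one_iff (h2 : (Ideal.span {(2 : 𝓞 K)}).IsPrime) {a b : 𝓞 K}
    (ha : ¬ 2 ∣ a) (hb : ¬ 2 ∣ b) :
    hilbertSymbol (placeTwo h2) (a : K) (b : K) = 1 ↔ IsSolvableModFour a b := by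
  refine ite_one_neg_one_eq_one_iff.trans ?_
  constructor
  · rintro ⟨x, y, z, hxyz, h⟩
    exact .of_solution (placeTwo h2) rfl hxyz h
  · exact fun h ↦ h.exists_solution (placeTwo h2) rfl ha hb

/-! ### Galois invariance and dependence on the class mod four -/

theorem dvd_smul_of_dvd {n : ℕ} {r : 𝓞 K} (τ : Gal(K/ℚ)) (h : (n : 𝓞 K) ∣ r) :
    (n : 𝓞 K) ∣ τ • r := by
  have := map_dvd (MulSemiringAction.toRingHom Gal(K/ℚ) (𝓞 K) τ) h
  rwa [map_natCast] at this

theorem IsSolvableModFour.of_smul {a b : 𝓞 K} {τ : Gal(K/ℚ)}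
    (h : IsSolvableModFour (τ • a) (τ • b)) : IsSolvableModFour a b := by
  obtain ⟨x, y, z, hxyz, h⟩ := h
  refine ⟨τ⁻¹ • x, τ⁻¹ • y, τ⁻¹ • z, ?_, ?_⟩
  · have hprim {r : 𝓞 K} (hr : ¬ 2 ∣ r) : ¬ 2 ∣ τ⁻¹ • r := fun h ↦
      hr (by simpa using dvd_smul_of_dvd (n := 2) τ h)
    exact hxyz.imp hprim (Or.imp hprim hprim)
  · have := dvd_smul_of_dvd (n := 4) τ⁻¹ (by exact_mod_cast h)
    simpa [smul_sub, smul_add, smul_mul', smul_pow'] using this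

theorem IsSolvableModFour.of_congr (h2 : (Ideal.span {(2 : 𝓞 K)}).IsPrime) {a b a' b' c d : 𝓞 K}
    (hc : ¬ 2 ∣ c) (hd : ¬ 2 ∣ d) (haa : 4 ∣ a - a' * c ^ 2) (hbb : 4 ∣ b - b' * d ^ 2)
    (h : IsSolvableModFour a b) : IsSolvableModFour a' b' := by
  have hp : Prime (2 : 𝓞 K) := (Ideal.span_singleton_prime two_ne_zero).1 h2
  obtain ⟨x, y, z, hxyz, h⟩ := h
  refine ⟨c * x, d * y, z, hxyz.imp (fun hx ↦ ?_) (Or.imp_left fun hy ↦ ?_), ?_⟩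
  · exact fun h ↦ (hp.dvd_or_dvd h).elim hc hx
  · exact fun h ↦ (hp.dvd_or_dvd h).elim hd hy
  · convert dvd_sub h (dvd_add (haa.mul_right (x ^ 2)) (hbb.mul_right (y ^ 2))) using 1
    ring

/-- A unit modulo four has an inverse modulo four. -/
theorem exists_inverse_mod_four {K : Type*} [Field K] {α : 𝓞 K} (hα : IsUnit (α : ResidueRing K 4)) :
    ∃ β : 𝓞 K, 4 ∣ α * β - 1 := by
  obtain ⟨β, hβ⟩ := hα.exists_right_inv
  obtain ⟨β, rfl⟩ := Ideal.Quotient.mk_surjective β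
  refine ⟨β, ?_⟩
  have h : α * β - 1 ∈ Ideal.span {((4 : ℕ) : 𝓞 K)} := Ideal.Quotient.eq.1 hβ
  exact_mod_cast Ideal.mem_span_singleton.1 h

theorem not_two_dvd_of_mul_congr_one (h2 : (Ideal.span {(2 : 𝓞 K)}).IsPrime) {α β : 𝓞 K}
    (h : 4 ∣ α * β - 1) : ¬ 2 ∣ α := by
  intro hα
  have h24 : (2 : 𝓞 K) ∣ 4 := ⟨2, by norm_num⟩
  have : (2 : 𝓞 K) ∣ 1 := by
    simpa using dvd_sub (hα.mul_right β) (h24.trans h)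
  exact ((Ideal.span_singleton_prime two_ne_zero).1 h2).not_dvd_one this

theorem starValue_eq_one_iff (h2 : (Ideal.span {(2 : 𝓞 K)}).IsPrime) {α : 𝓞 K}
    (hα : ¬ 2 ∣ α) :
    starValue h2 α = 1 ↔ ∀ σ : Gal(K/ℚ), σ ≠ 1 → IsSolvableModFour α (σ • α) := by
  refine ite_one_neg_one_eq_one_iff.trans ?_
  refine forall₂_congr fun σ _ ↦ hilbertSymbol_placeTwo_eq_one_iff h2 hα fun h ↦ hα ?_
  simpa using dvd_smul_of_dvd (n := 2) σ⁻¹ h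

theorem starValue_eq_one_of_congr [IsMulCommutative Gal(K/ℚ)]
    (h2 : (Ideal.span {(2 : 𝓞 K)}).IsPrime) {α β γ : 𝓞 K} {τ : Gal(K/ℚ)} (hα : ¬ 2 ∣ α)
    (hβ : ¬ 2 ∣ β) (hγ : ¬ 2 ∣ γ) (h : 4 ∣ α - (τ • β) * γ ^ 2) (hs : starValue h2 α = 1) :
    starValue h2 β = 1 := by
  rw [starValue_eq_one_iff h2 hα] at hs
  rw [starValue_eq_one_iff h2 hβ]
  intro σ hσ
  -- Applying `σ` to the congruence and using `στ = τσ` compares `(α, σα)` with `(τβ, τσβ)`, which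
  -- `τ` pulls back to `(β, σβ)`.
  refine .of_smul (τ := τ) (.of_congr h2 (c := γ) (d := σ • γ) hγ (fun hd ↦ hγ ?_) h ?_ (hs σ hσ))
  · simpa using dvd_smul_of_dvd (n := 2) σ⁻¹ hd
  · have := dvd_smul_of_dvd (n := 4) σ (by exact_mod_cast h)
    rw [smul_smul, mul_comm' τ σ, ← smul_smul]
    simpa [smul_sub, smul_mul', smul_pow'] using this

/-- The relation is symmetric: since `α` is invertible mod `4`, so is `γ`, hence `β` is congruent to
`τ⁻¹α` times a square and the one-way implication applies both ways. -/
theorem starValue_congr [IsMulCommutative Gal(K/ℚ)] (h2 : (Ideal.span {(2 : 𝓞 K)}).IsPrime)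
    {α β γ : 𝓞 K} {τ : Gal(K/ℚ)} (hα : IsUnit (α : ResidueRing K 4))
    (hβ : IsUnit (β : ResidueRing K 4)) (h : 4 ∣ α - (τ • β) * γ ^ 2) :
    starValue h2 α = starValue h2 β := by
  obtain ⟨α', hα'⟩ := exists_inverse_mod_four hα
  obtain ⟨β', hβ'⟩ := exists_inverse_mod_four hβ
  have hα2 := not_two_dvd_of_mul_congr_one h2 hα'
  have hβ2 := not_two_dvd_of_mul_congr_one h2 hβ'
  -- an inverse of `γ` modulo four
  set δ : 𝓞 K := (τ • β) * γ * α' with hδ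
  have hγδ : 4 ∣ γ * δ - 1 := by
    convert dvd_sub hα' (h.mul_right α') using 1
    ring
  have hγ2 := not_two_dvd_of_mul_congr_one h2 hγδ
  have hδ2 : ¬ 2 ∣ δ := not_two_dvd_of_mul_congr_one h2 (mul_comm γ δ ▸ hγδ)
  have hback : 4 ∣ β - (τ⁻¹ • α) * (τ⁻¹ • δ) ^ 2 := by
    have h4 : 4 ∣ τ • β - α * δ ^ 2 := by
      convert dvd_sub (hγδ.mul_right (-(τ • β) * (γ * δ + 1))) (h.mul_right (δ ^ 2)) using 1
      ring
    have := dvd_smul_of_dvd (n := 4) τ⁻¹ (by exact_mod_cast h4)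
    simpa [smul_sub, smul_mul', smul_pow'] using this
  have hiff : starValue h2 α = 1 ↔ starValue h2 β = 1 :=
    ⟨starValue_eq_one_of_congr h2 hα2 hβ2 hγ2 h,
      starValue_eq_one_of_congr h2 hβ2 hα2
        (fun hd ↦ hδ2 (by simpa using dvd_smul_of_dvd (n := 2) τ hd)) hback⟩
  rcases Int.units_eq_one_or (starValue h2 α) with ha | ha <;>
    rcases Int.units_eq_one_or (starValue h2 β) with hb | hb <;> simp_all

/-! ### Descent to Galois orbits -/

theorem MOrbits.mk_surjective (q : ℕ) (x : MOrbits K q) :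
    ∃ (α : 𝓞 K) (hα : IsUnit (α : ResidueRing K q)), MOrbits.mk q α hα = x := by
  obtain ⟨m, rfl⟩ := Quotient.mk_surjective x
  obtain ⟨u, rfl⟩ := QuotientGroup.mk'_surjective _ m
  obtain ⟨α, hα⟩ := Ideal.Quotient.mk_surjective (u : ResidueRing K q)
  have hu : IsUnit (α : ResidueRing K q) := ⟨u, hα.symm⟩
  exact ⟨α, hu, congrArg (fun w ↦ Quotient.mk _ (M.ofUnit q w)) (Units.ext hα)⟩

theorem MOrbits.exists_congr_of_mk_eq {q : ℕ} {α β : 𝓞 K} {hα : IsUnit (α : ResidueRing K q)}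
    {hβ : IsUnit (β : ResidueRing K q)} (h : MOrbits.mk q α hα = MOrbits.mk q β hβ) :
    ∃ (τ : Gal(K/ℚ)) (γ : 𝓞 K), (q : 𝓞 K) ∣ α - (τ • β) * γ ^ 2 := by
  obtain ⟨τ, hτ⟩ := Quotient.exact h
  obtain ⟨_, ⟨g, rfl⟩, hg⟩ := (QuotientGroup.mk'_eq_mk' _).1 hτ
  obtain ⟨γ, hγ⟩ := Ideal.Quotient.mk_surjective (g : ResidueRing K q)
  refine ⟨τ, γ, ?_⟩
  rw [← Ideal.mem_span_singleton, ← Ideal.Quotient.eq, map_mul, map_pow, hγ]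
  exact (congrArg Units.val hg).symm

end Starlight

theorem mainTheorem5 (K : Type*) [Field K] [NumberField K] [IsTotallyReal K]
    [IsGalois ℚ K] [IsCyclic Gal(K/ℚ)] (n : ℕ) (hn : n.Prime) (hodd : Odd n)
    (hdeg : Module.finrank ℚ K = n) (hclass : Odd (classNumber K))
    (h2 : (Ideal.span {(2 : 𝓞 K)}).IsPrime)
    (hunits : ∀ u : (𝓞 K)ˣ, Starlight.IsTotallyPositive ((u : 𝓞 K) : K) → IsSquare u) :
    (∃! star : Starlight.MOrbits K 4 → ℤˣ,
      ∀ (α : 𝓞 K) (hα : IsUnit (α : Starlight.ResidueRing K 4)),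
        star (Starlight.MOrbits.mk 4 α hα) = Starlight.starValue h2 α) ∧
    (∀ (α β γ : 𝓞 K) (τ : Gal(K/ℚ)), IsUnit (α : Starlight.ResidueRing K 4) →
      IsUnit (β : Starlight.ResidueRing K 4) →
      α - (τ • β) * γ ^ 2 ∈ Ideal.span {(4 : 𝓞 K)} →
        Starlight.starValue h2 α = Starlight.starValue h2 β) := by
  have hcongr (α β γ : 𝓞 K) (τ : Gal(K/ℚ)) (hα : IsUnit (α : Starlight.ResidueRing K 4))
      (hβ : IsUnit (β : Starlight.ResidueRing K 4))
      (h : α - (τ • β) * γ ^ 2 ∈ Ideal.span {(4 : 𝓞 K)}) :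
      Starlight.starValue h2 α = Starlight.starValue h2 β :=
    Starlight.starValue_congr h2 hα hβ (Ideal.mem_span_singleton.1 h)
  refine ⟨?_, hcongr⟩
  -- Evaluating `starValue` on chosen representatives defines the map; as they exhaust the orbits,
  -- it is unique.
  choose rep hrep hmk using Starlight.MOrbits.mk_surjective (K := K) 4
  refine ⟨fun x ↦ Starlight.starValue h2 (rep x), fun α hα ↦ ?_, fun star hstar ↦ ?_⟩
  · obtain ⟨τ, γ, h⟩ := Starlight.MOrbits.exists_congr_of_mk_eq (hmk (Starlight.MOrbits.mk 4 α hα))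
    exact hcongr _ _ γ τ (hrep _) hα (Ideal.mem_span_singleton.2 (by exact_mod_cast h))
  · funext x
    rw [← hstar (rep x) (hrep x), hmk]
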